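/- **Setting.** Let $q$ be a prime power and let $b$ be a basis of $\mathbb F_{q^s}$ over $\mathbb F_q$. For $v\in\mathbb F_{q^s}^n$ let $\Phi(v)$ be the $n\times s$ matrix over $\mathbb F_q$ whose rows are the coordinate vectors of the entries of $v$; the rank distance of $v,w$ is $\operatorname{rk}_q\Phi(v-w)$. Let $n=\rho l$ and let $\alpha_1,\dots,\alpha_n\in\mathbb F_{q^s}$ be linearly independent over $\mathbb F_q$. The Gabidulin code $\mathcal G(n,\kappa)$ is the set of all $(h(\alpha_1),\dots,h(\alpha_n))$ with $h(z)=\sum_{a<\kappa}h_az^{q^a}$, $h_a\in\mathbb F_{q^s}$. Let $k,t,\beta\ge 1$ with $k+t\rho+\beta-1\le n$. There are $m$ files. File $X^g$ consists of $\beta$ stripes, each a vector of $k$ symbols of $\mathbb F_{q^s}$; stripe $\delta$ of file $g$ gives the polynomial $x_{g,\delta}(z)=\sum_{a<k}X^g_{\delta,a}z^{q^a}$, and its codeword in $\mathcal C=\mathcal G(n,k)$ is stored, $\rho$ symbols on each of $l$ servers. To retrieve file $X^f$ the user sends queries in rounds $i=1,\dots,k$. The query matrix $D_Q^{(i)}=D^{(i)\top}+E^{f,(i)}\in\mathbb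 F_{q^s}^{n\times m\beta}$ has one column per stripe: each column of $D^{(i)\top}$ is a (random) codeword of $\mathcal D=\mathcal G(n,t\rho)$; the column of $E^{f,(i)}$ for stripe $\delta$ of file $f$ is $(\alpha_j^{q^{e}})_j$ with $e=i\beta-\delta k+k+t\rho-1$ if $\delta\le\lceil i\beta/k\rceil$, and all other columns of $E^{f,(i)}$ are $0$. For a matrix $Q\in\mathbb F_{q^s}^{n\times m\beta}$ the star product $Y\star Q\in\mathbb F_{q^s}^n$ has entries $\sum_{g,\delta}x_{g,\delta}(Q_{j,(g,\delta)})$. Let $P^{(i)}(X)\in\mathbb F_{q^s}^n$ be the part of $Y\star D_Q^{(i)}$ that consists of the terms $X^f_{\delta,a}\alpha_j^{q^{e+a}}$, $\delta\le\lceil i\beta/k\rceil$, with $e+a\ge k+t\rho+\beta-1$ (symbols of $X^f$ already retrieved in earlier rounds). The response code $\mathcal C\star(\mathcal D+\mathcal E^f)$ of round $i$ is the $\mathbb F_{q^s}$-span of all words $Y\star D_Q^{(i)}-P^{(i)}(X)$, over all data $X$ and all choices of $D^{(i)}$; let $d$ be its minimum rank distance. **Network.** In round $i$ the uplink is error-free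 with a block-diagonal transfer matrix $A^{(i)}\in\mathbb F_q^{n\times n}$ (one $\rho\times\rho$ block per server): the servers receive $A^{(i)}$ and $A^{(i)}D_Q^{(i)}$ and answer with the lifted matrix $(I\mid A^{(i)}\mid \Phi(Y\star(A^{(i)}D_Q^{(i)})))$. The downlink has a block-diagonal transfer matrix $A'^{(i)}\in\mathbb F_q^{n\times n}$ and an error matrix $N_e^{(i)}\in\mathbb F_q^{n\times(2n+s)}$, so the user receives $$A'^{(i)}\,(I\mid A^{(i)}\mid\Phi(Y\star(A^{(i)}D_Q^{(i)})))+N_e^{(i)} .$$ The network introduces (at most) $\epsilon$ rank errors and $\tau$ erasures if $\operatorname{rk}_q N_e^{(i)}\le\epsilon$ and $\operatorname{rk}_q(A'^{(i)}A^{(i)})\ge n-\tau$ for every $i$ (the latter is $\operatorname{rk}_q A'^{(i)}\ge n-\tau$ when $A^{(i)}$ is invertible). **Theorem.** (1) In every round the response code $\mathcal C\star(\mathcal D+\mathcal E^f)$ equals $\mathcal G(n,k+t\rho+\beta-1)$ and $d=n-k-t\rho-\beta+2$. In particular $\beta=n-k-t\rho-2\epsilon-\tau+1$ stripes satisfy $2\epsilon+\tau\le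 d-1$. (2) If $2\epsilon+\tau\le d-1$, then the user can correct the errors and erasures and retrieve the file: there is a decoding map, depending only on the parameters of the scheme and on $f$, which from the $k$ received matrices returns all the error-free responses $Y\star D_Q^{(1)},\dots,Y\star D_Q^{(k)}$ and the file $X^f$, for all data $X$, all $D^{(i)}$ and all $A^{(i)},A'^{(i)},N_e^{(i)}$ with at most $\epsilon$ rank errors and $\tau$ erasures in each round. The rate, that is, the size of the file ($\beta k$ symbols of $\mathbb F_{q^s}$) divided by the number of response symbols downloaded from the $l$ servers ($k\rho$ symbols of $\mathbb F_{q^s}$ each, lifting headers not counted), is $\beta/n$. -/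

import Mathlib

open Matrix

namespace RankPIR

/-- The value `∑ a, c a * x ^ (q ^ a)` of the linearized polynomial with coefficients `c`. -/
def linEval (q : ℕ) {K : Type*} [CommSemiring K] {k : ℕ} (c : Fin k → K) (x : K) : K :=
  ∑ a : Fin k, c a * x ^ q ^ (a : ℕ)

/-- Gabidulin encoding: a linearized polynomial of `q`-degree less than `k` is evaluated at the
points `α j`. -/
def gabEncode {ι K : Type*} [Field K] (q : ℕ) (α : ι → K) (k : ℕ) :
    (Fin k → K) →ₗ[K] (ι → K) where
  toFun c j := linEval q c (α j)
  map_add' c c' := by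
    funext j
    simp [linEval, add_mul, Finset.sum_add_distrib]
  map_smul' a c := by
    funext j
    simp [linEval, Finset.mul_sum, mul_assoc]

/-- The Gabidulin code `G(n, k)` with evaluation points `α`, where `n` is the number of points. -/
def gabidulin {ι K : Type*} [Field K] (q : ℕ) (α : ι → K) (k : ℕ) : Submodule K (ι → K) :=
  LinearMap.range (gabEncode q α k)

/-- The matrix over `F` of a word over the extension field `K`: row `j` holds the coordinates of
the `j`-th symbol in the basis `b`. -/
noncomputable def expand {F K ι : Type*} [Field F] [Field K] [Algebra F K] {s : ℕ}
    (b : Module.Basis (Fin s) F K) (v : ι → K) : Matrix ι (Fin s) F :=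
  Matrix.of fun j a => b.repr (v j) a

/-- Minimum rank distance: the least rank over `F` of a difference of two distinct codewords. -/
noncomputable def minRankDist {F K ι : Type*} [Field F] [Field K] [Algebra F K] {s : ℕ}
    (b : Module.Basis (Fin s) F K) (C : Set (ι → K)) : ℕ :=
  sInf {w | ∃ x ∈ C, ∃ y ∈ C, x ≠ y ∧ w = (expand b (x - y)).rank}

/-- The random part of the queries. Row `(g, δ)` belongs to stripe `δ` of file `g` and is the
codeword of `G(n, T)` with message polynomial `U (g, δ)`. -/
def randomPart {ι K R : Type*} [Field K] (q : ℕ) (α : ι → K) {T : ℕ} (U : R → Fin T → K) :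
    Matrix R ι K :=
  Matrix.of fun r => gabEncode q α T (U r)

/-- Exponent `e` of the monomial `z ^ (q ^ e)` which asks for stripe `δ` in round `i`. Rounds and
stripes are counted from `0`; in terms of `i' = i + 1` and `δ' = δ + 1` it is
`i' * β - δ' * k + k + T - 1`. -/
def reqExp (β k T i δ : ℕ) : ℕ := (i + 1) * β + T - 1 - δ * k

/-- The stripes asked for in round `i`; in terms of `i' = i + 1` and `δ' = δ + 1` the condition
reads `δ' ≤ ⌈i' * β / k⌉`. -/
def Requested (β k i δ : ℕ) : Prop := δ * k < (i + 1) * β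

instance (β k i δ : ℕ) : Decidable (Requested β k i δ) :=
  inferInstanceAs (Decidable (_ < _))

/-- The deterministic part of the queries for file `f` in round `i`: in the column of each
requested stripe `δ` of file `f` it has the codeword of `z ^ (q ^ e)`, with `e` as above. -/
def requestPart {ι K : Type*} [Field K] (q : ℕ) (α : ι → K) {m β : ℕ} (k T : ℕ) (f : Fin m)
    (i : ℕ) : Matrix ι (Fin m × Fin β) K :=
  Matrix.of fun j r =>
    if r.1 = f ∧ Requested β k i r.2 then α j ^ q ^ reqExp β k T i r.2 else 0

/-- The query matrix of round `i`; row `j` is meant for sub-server `j`. -/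
def queryMatrix {ι K : Type*} [Field K] (q : ℕ) (α : ι → K) {m β T : ℕ} (k : ℕ) (f : Fin m)
    (i : ℕ) (U : Fin m × Fin β → Fin T → K) : Matrix ι (Fin m × Fin β) K :=
  (randomPart q α U)ᵀ + requestPart q α k T f i

/-- The star product of the stored data with a matrix `Q` of queries. Row `r` of the stored data is
the Gabidulin codeword of the linearized polynomial `x_r` with coefficients `X r`. If column `r`
of `Q` is the codeword of `g_r`, then entry `j` is `∑ r, x_r (g_r (α j))`, that is, the stripes
contribute the codewords of the compositions of `x_r` and `g_r`, and their sum is returned. -/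
def starProd {ι K R : Type*} [Field K] [Fintype R] (q : ℕ) {k : ℕ} (X : Matrix R (Fin k) K)
    (Q : Matrix ι R K) : ι → K :=
  fun j => ∑ r, linEval q (X r) (Q j r)

/-- File number `f`: its `β` stripes of `k` symbols each. -/
def file {K : Type*} {m β k : ℕ} (X : Matrix (Fin m × Fin β) (Fin k) K) (f : Fin m) :
    Matrix (Fin β) (Fin k) K :=
  Matrix.of fun δ a => X (f, δ) a

/-- The part of the round `i` response with exponents at least `k + T + β - 1`. It consists of
symbols of the requested file which earlier rounds have already delivered. -/
def padding {ι K : Type*} [Field K] (q : ℕ) (α : ι → K) {m β k : ℕ} (T : ℕ) (f : Fin m) (i : ℕ)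
    (X : Matrix (Fin m × Fin β) (Fin k) K) : ι → K :=
  fun j => ∑ δ : Fin β, ∑ a : Fin k,
    if Requested β k i δ ∧ k + T + β - 1 ≤ reqExp β k T i δ + a then
      X (f, δ) a * α j ^ q ^ (reqExp β k T i δ + a)
    else 0

/-- The response code of round `i`, spanned by the star products of all data with all possible
queries for file `f`, after removal of the symbols known from earlier rounds. -/
def responseCode {ι K : Type*} [Field K] (q : ℕ) (α : ι → K) {m : ℕ} (β k T : ℕ) (f : Fin m)
    (i : ℕ) : Submodule K (ι → K) :=
  Submodule.span K {w | ∃ (X : Matrix (Fin m × Fin β) (Fin k) K)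
    (U : Fin m × Fin β → Fin T → K),
      w = starProd q X (queryMatrix q α k f i U) - padding q α T f i X}

/-- What the sub-servers receive if the uplink has transfer matrix `A` and makes no errors. -/
def uplink {F K ι R : Type*} [Field F] [Field K] [Algebra F K] [Fintype ι]
    (A : Matrix ι ι F) (Q : Matrix ι R K) : Matrix ι R K :=
  A.map (algebraMap F K) * Q

/-- What the user receives: the lifted responses `(I | A | w)` pass through the downlink, which has
transfer matrix `A'` and adds the error matrix `N`. -/
noncomputable def downlink {F K ι : Type*} [Field F] [Field K] [Algebra F K] [Fintype ι]
    [DecidableEq ι] {s : ℕ} (b : Module.Basis (Fin s) F K) (A A' : Matrix ι ι F) (w : ι → K)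
    (N : Matrix ι (ι ⊕ (ι ⊕ Fin s)) F) : Matrix ι (ι ⊕ (ι ⊕ Fin s)) F :=
  A' * fromCols 1 (fromCols A (expand b w)) + N

/-- Size of the file divided by the total size of the downloads from `l` servers, both counted in
symbols of `F`, if the download from one server ranges over `Download`. -/
noncomputable def pirRate (F File Download : Type*) [Field F] [AddCommGroup File] [Module F File]
    [AddCommGroup Download] [Module F Download] (l : ℕ) : ℚ :=
  Module.finrank F File / (l * Module.finrank F Download)

end RankPIR

open RankPIR

namespace RankPIR

/-! A response word evaluates a linearized polynomial at the points `α`. Give symbol `a` of stripe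
`δ` of the requested file the position `v = δ * k + (k - 1 - a)`, with indices from `0`. In round
`i` it sits at exponent `(i + 1) * β + T + k - 2 - v`, so distinct symbols never collide. The random
part ends at exponent `k + T - 2`, hence exactly the symbols with `v < (i + 1) * β` lie clear of it;
those with `v < i * β` form the padding. Each round thus exposes `β` new symbols, and the other
coefficients fill out a Gabidulin code (`responseCode_eq_gabidulin`), whose distance comes from a
root count and a Singleton argument (`minRankDist_gabidulin`).

Decoding is shown to be possible by uniqueness. If two scenarios produce the same received matrices,
a Sylvester estimate bounds the rank distance of their responses by `2 * ε + τ`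
(`rank_expand_sub_le_of_downlink_eq`). By induction on the rounds both have the same padding; after
subtracting it both words lie in the response code and must coincide, which makes the next `β`
symbols agree (`responses_eq_of_rank_lt`). So the result is a function of what is received. -/

/-! ### Rank inequalities over a field -/

theorem finrank_le_finrank_map_add_finrank_ker {F V W : Type*} [Field F] [AddCommGroup V]
    [Module F V] [FiniteDimensional F V] [AddCommGroup W] [Module F W] (f : V →ₗ[F] W)
    (S : Submodule F V) :
    Module.finrank F S ≤
      Module.finrank F (S.map f) + Module.finrank F (LinearMap.ker f) := by
  have h := (f.domRestrict S).finrank_range_add_finrank_ker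
  rw [LinearMap.range_domRestrict] at h
  have hker : Module.finrank F (LinearMap.ker (f.domRestrict S)) ≤
      Module.finrank F (LinearMap.ker f) := by
    refine LinearMap.finrank_le_finrank_of_injective
      (f := (S.subtype.comp (LinearMap.ker (f.domRestrict S)).subtype).codRestrict
        (LinearMap.ker f) fun x => ?_) ?_
    · exact x.2
    · intro x y hxy
      have := congrArg Subtype.val hxy
      exact Subtype.ext (Subtype.ext this)
  omega

/-- Sylvester's inequality: `B` can collapse the range of `C` by at most the dimension of its
kernel. -/
theorem rank_add_rank_le_rank_mul_add_card {F l m n : Type*} [Field F] [Fintype m]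
    [Fintype n] (B : Matrix l m F) (C : Matrix m n F) :
    B.rank + C.rank ≤ (B * C).rank + Fintype.card m := by
  have h1 := finrank_le_finrank_map_add_finrank_ker B.mulVecLin (LinearMap.range C.mulVecLin)
  have h2 := B.mulVecLin.finrank_range_add_finrank_ker
  rw [← LinearMap.range_comp, ← Matrix.mulVecLin_mul] at h1
  rw [Module.finrank_pi] at h2
  simp only [Matrix.rank]
  omega

theorem rank_sub_le_add {F m n : Type*} [Field F] [Finite m] [Fintype n]
    (A B : Matrix m n F) : (A - B).rank ≤ A.rank + B.rank := by
  have h : LinearMap.range (A - B).mulVecLin ≤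
      LinearMap.range A.mulVecLin ⊔ LinearMap.range B.mulVecLin := by
    rintro _ ⟨v, rfl⟩
    rw [Matrix.mulVecLin_apply, Matrix.sub_mulVec]
    exact Submodule.sub_mem_sup ⟨v, rfl⟩ ⟨v, rfl⟩
  exact (Submodule.finrank_mono h).trans (Submodule.finrank_add_le_finrank_add_finrank _ _)

/-! ### Gabidulin codes have maximum rank distance -/

/-- A linearized polynomial as a map which is linear over the base field. -/
noncomputable def linMap (F : Type*) {K : Type*} [Field F] [Fintype F] [Field K] [Algebra F K]
    {N : ℕ} (c : Fin N → K) : K →ₗ[F] K :=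
  ∑ a : Fin N, c a • (FiniteField.frobeniusAlgHom F K ^ (a : ℕ)).toLinearMap

theorem linMap_apply {F K : Type*} [Field F] [Fintype F] [Field K] [Algebra F K] {N : ℕ}
    (c : Fin N → K) (x : K) : linMap F c x = linEval (Fintype.card F) c x := by
  simp [linMap, linEval, LinearMap.sum_apply, AlgHom.coe_pow, FiniteField.coe_frobeniusAlgHom,
    pow_iterate]

/-- A kernel of dimension `d` gives `q ^ d` roots of a nonzero polynomial of degree at most `q ^ (N
- 1)`. -/
theorem finrank_ker_linMap_lt {F K : Type*} [Field F] [Fintype F] [Field K] [Algebra F K]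
    [FiniteDimensional F K] {N : ℕ} {c : Fin N → K} (hc : c ≠ 0) :
    Module.finrank F (LinearMap.ker (linMap F c)) < N := by
  classical
  have hq : 1 < Fintype.card F := Fintype.one_lt_card
  obtain ⟨a₀, ha₀⟩ := Function.ne_iff.mp hc
  have hN : 0 < N := a₀.pos
  let p : Polynomial K := ∑ a : Fin N, Polynomial.monomial (Fintype.card F ^ (a : ℕ)) (c a)
  have hp : p ≠ 0 := by
    intro h
    apply ha₀
    have := congrArg (fun r => Polynomial.coeff r (Fintype.card F ^ (a₀ : ℕ))) h
    simpa [p, Polynomial.finsetSum_coeff, Polynomial.coeff_monomial,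
      (Nat.pow_right_injective hq).eq_iff, Fin.val_inj] using this
  have hdeg : p.natDegree ≤ Fintype.card F ^ (N - 1) := by
    refine Polynomial.natDegree_sum_le_of_forall_le _ _ fun a _ => ?_
    refine (Polynomial.natDegree_monomial_le _).trans ?_
    exact Nat.pow_le_pow_right hq.le (by omega)
  have : Finite K := Module.finite_of_finite F
  let _ : Fintype K := Fintype.ofFinite K
  have hcard : Fintype.card (LinearMap.ker (linMap F c)) ≤ p.roots.toFinset.card := by
    rw [← Fintype.card_coe]
    refine Fintype.card_le_of_injective (fun x => ⟨x.1, ?_⟩) ?_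
    · have hx := x.2
      rw [LinearMap.mem_ker, linMap_apply] at hx
      rw [Multiset.mem_toFinset, Polynomial.mem_roots hp, Polynomial.IsRoot.def]
      simpa [p, Polynomial.eval_finsetSum, linEval] using hx
    · intro x y h
      exact Subtype.ext (by simpa using h)
  have h := (hcard.trans (Multiset.toFinset_card_le _)).trans
    ((Polynomial.card_roots' p).trans hdeg)
  rw [Module.card_eq_pow_finrank (K := F)] at h
  have := (Nat.pow_le_pow_iff_right hq).mp h
  omega

theorem rank_expand {F K ι : Type*} [Field F] [Field K] [Algebra F K] [Finite ι] {s : ℕ}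
    (b : Module.Basis (Fin s) F K) (v : ι → K) :
    (expand b v).rank = Module.finrank F (Submodule.span F (Set.range v)) := by
  rw [Matrix.rank_eq_finrank_span_row]
  have h : Set.range (expand b v).row = b.equivFun '' Set.range v := by
    rw [← Set.range_comp]
    rfl
  rw [h]
  have := LinearEquiv.finrank_map_eq b.equivFun (Submodule.span F (Set.range v))
  rw [← this, Submodule.map_span]
  rfl

/-- The symbols of the codeword span the image of the span of `α`, which loses less than `N`
dimensions. -/
theorem card_lt_rank_expand_gabEncode_add {F K ι : Type*} [Field F] [Fintype F] [Field K]
    [Algebra F K] [Fintype ι] {s N : ℕ} (b : Module.Basis (Fin s) F K) {α : ι → K}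
    (hα : LinearIndependent F α) {c : Fin N → K} (hc : c ≠ 0) :
    Fintype.card ι < (expand b (gabEncode (Fintype.card F) α N c)).rank + N := by
  have : FiniteDimensional F K := b.finiteDimensional_of_finite
  have h1 := finrank_le_finrank_map_add_finrank_ker (linMap F c) (Submodule.span F (Set.range α))
  have h2 : (Submodule.span F (Set.range α)).map (linMap F c) =
      Submodule.span F (Set.range (gabEncode (Fintype.card F) α N c)) := by
    rw [Submodule.map_span, ← Set.range_comp]
    congr 2
    funext j
    exact linMap_apply c (α j)
  rw [h2, finrank_span_eq_card hα, ← rank_expand b] at h1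
  have h3 := finrank_ker_linMap_lt (F := F) hc
  omega

theorem gabEncode_injective {F K ι : Type*} [Field F] [Fintype F] [Field K]
    [Algebra F K] [Fintype ι] {s N : ℕ} (b : Module.Basis (Fin s) F K) {α : ι → K}
    (hα : LinearIndependent F α) (hN : N ≤ Fintype.card ι) :
    Function.Injective (gabEncode (Fintype.card F) α N) := by
  rw [← LinearMap.ker_eq_bot, LinearMap.ker_eq_bot']
  intro c hc
  by_contra h
  have := card_lt_rank_expand_gabEncode_add b hα h
  rw [hc] at this
  have h0 : expand b (0 : ι → K) = 0 := by ext; simp [expand]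
  rw [h0, Matrix.rank_zero] at this
  omega

/-- Singleton bound: `N` coefficients suffice to make `N - 1` chosen entries vanish, and the
remaining rows bound the rank. -/
theorem exists_gabEncode_rank_le {F K ι : Type*} [Field F] [Fintype F] [Field K]
    [Algebra F K] [Fintype ι] {s N : ℕ} (b : Module.Basis (Fin s) F K) (α : ι → K)
    (hN : 0 < N) (hn : N ≤ Fintype.card ι) :
    ∃ c : Fin N → K, c ≠ 0 ∧
      (expand b (gabEncode (Fintype.card F) α N c)).rank + N ≤ Fintype.card ι + 1 := by
  classical
  obtain ⟨S, -, hS⟩ := Finset.exists_subset_card_eq (s := (Finset.univ : Finset ι))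
    (n := N - 1) (by rw [Finset.card_univ]; omega)
  let g : (Fin N → K) →ₗ[K] (S → K) :=
    (LinearMap.funLeft K K Subtype.val).comp (gabEncode (Fintype.card F) α N)
  have hg : LinearMap.ker g ≠ ⊥ := by
    apply LinearMap.ker_ne_bot_of_finrank_lt
    rw [Module.finrank_pi, Module.finrank_pi, Fintype.card_coe, hS, Fintype.card_fin]
    omega
  obtain ⟨c, hcg, hc⟩ := (Submodule.ne_bot_iff _).mp hg
  refine ⟨c, hc, ?_⟩
  have hle := Matrix.rank_le_card_of_support_subset
    (expand b (gabEncode (Fintype.card F) α N c)) Sᶜ (by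
      rw [Function.support_subset_iff']
      intro j hj
      have hjS : j ∈ S := by simpa using hj
      have h0 : gabEncode (Fintype.card F) α N c j = 0 :=
        congrFun (LinearMap.mem_ker.mp hcg) ⟨j, hjS⟩
      funext a
      simp [Matrix.row, expand, h0])
  rw [Finset.card_compl, hS] at hle
  omega

theorem minRankDist_gabidulin {F K ι : Type*} [Field F] [Fintype F] [Field K]
    [Algebra F K] [Fintype ι] {s N : ℕ} (b : Module.Basis (Fin s) F K) {α : ι → K}
    (hα : LinearIndependent F α) (hN : 0 < N) (hn : N ≤ Fintype.card ι) :
    minRankDist b (gabidulin (Fintype.card F) α N : Set (ι → K)) + N = Fintype.card ι + 1 := by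
  obtain ⟨c, hc, hcr⟩ := exists_gabEncode_rank_le b α hN hn
  have hmem : (expand b (gabEncode (Fintype.card F) α N c)).rank ∈
      {w | ∃ x ∈ (gabidulin (Fintype.card F) α N : Set (ι → K)),
        ∃ y ∈ (gabidulin (Fintype.card F) α N : Set (ι → K)),
          x ≠ y ∧ w = (expand b (x - y)).rank} := by
    refine ⟨_, ⟨c, rfl⟩, 0, Submodule.zero_mem _, ?_, by rw [sub_zero]⟩
    intro h
    exact hc (gabEncode_injective b hα hn (by rw [h, map_zero]))
  have h1 := Nat.sInf_le hmem
  obtain ⟨_, ⟨c₁, rfl⟩, _, ⟨c₂, rfl⟩, hne, hw⟩ := Nat.sInf_mem ⟨_, hmem⟩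
  rw [← map_sub] at hw
  have h2 := card_lt_rank_expand_gabEncode_add b hα (c := c₁ - c₂)
    (fun h => hne (by rw [sub_eq_zero.mp h]))
  rw [← hw] at h2
  unfold minRankDist
  omega

/-! ### Responses as linearized polynomials -/

/-- Coefficient of the `q`-degree `c` monomial of the response of round `i`. -/
def respCoeff {K : Type*} [Field K] (q : ℕ) {m k β T : ℕ} (f : Fin m) (i : ℕ)
    (X : Matrix (Fin m × Fin β) (Fin k) K) (U : Fin m × Fin β → Fin T → K) (c : ℕ) : K :=
  (∑ p : (Fin m × Fin β) × Fin k × Fin T,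
    if (p.2.1 : ℕ) + p.2.2 = c then X p.1 p.2.1 * U p.1 p.2.2 ^ q ^ (p.2.1 : ℕ) else 0) +
  ∑ p : Fin β × Fin k,
    if reqExp β k T i p.1 + p.2 = c then
      (if Requested β k i p.1 then X (f, p.1) p.2 else 0) else 0

theorem sum_fiber_mul_pow {K P : Type*} [Field K] [Fintype P] (q N : ℕ) (e : P → ℕ) (z : P → K)
    (x : K) :
    ∑ d : Fin N, (∑ p, if e p = d then z p else 0) * x ^ q ^ (d : ℕ) =
      ∑ p, if e p < N then z p * x ^ q ^ e p else 0 := by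
  simp_rw [Finset.sum_mul]
  rw [Finset.sum_comm]
  refine Finset.sum_congr rfl fun p _ => ?_
  split_ifs with h
  · rw [Finset.sum_eq_single (⟨e p, h⟩ : Fin N)]
    · simp
    · intro d _ hd
      rw [if_neg (fun he => hd (Fin.ext he.symm)), zero_mul]
    · simp
  · refine Finset.sum_eq_zero fun d _ => ?_
    rw [if_neg (by have := d.2; omega), zero_mul]

theorem linEval_sum {F K P : Type*} [Field F] [Fintype F] [Field K] [Algebra F K] {N : ℕ}
    (c : Fin N → K) (S : Finset P) (g : P → K) :
    linEval (Fintype.card F) c (∑ p ∈ S, g p) = ∑ p ∈ S, linEval (Fintype.card F) c (g p) := by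
  simp_rw [← linMap_apply (F := F)]
  exact map_sum _ _ _

theorem linEval_linEval {F K : Type*} [Field F] [Fintype F] [Field K] [Algebra F K] {k T : ℕ}
    (c : Fin k → K) (u : Fin T → K) (x : K) :
    linEval (Fintype.card F) c (linEval (Fintype.card F) u x) =
      ∑ a : Fin k, ∑ d : Fin T, c a * u d ^ Fintype.card F ^ (a : ℕ) *
        x ^ Fintype.card F ^ ((a : ℕ) + d) := by
  rw [linEval.eq_1 _ u x, linEval_sum (F := F), Finset.sum_comm]
  refine Finset.sum_congr rfl fun d _ => Finset.sum_congr rfl fun a _ => ?_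
  rw [mul_pow, ← pow_mul, ← pow_add, add_comm (d : ℕ), mul_assoc]

theorem starProd_queryMatrix {F K ι : Type*} [Field F] [Fintype F] [Field K] [Algebra F K]
    {m k β T : ℕ} (α : ι → K) (f : Fin m) (i : ℕ) (X : Matrix (Fin m × Fin β) (Fin k) K)
    (U : Fin m × Fin β → Fin T → K) (j : ι) :
    starProd (Fintype.card F) X (queryMatrix (Fintype.card F) α k f i U) j =
      (∑ p : (Fin m × Fin β) × Fin k × Fin T, X p.1 p.2.1 *
        U p.1 p.2.2 ^ Fintype.card F ^ (p.2.1 : ℕ) *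
          α j ^ Fintype.card F ^ ((p.2.1 : ℕ) + p.2.2)) +
      ∑ p : Fin β × Fin k, (if Requested β k i p.1 then X (f, p.1) p.2 else 0) *
        α j ^ Fintype.card F ^ (reqExp β k T i p.1 + p.2) := by
  have hadd : ∀ (c : Fin k → K) (x y : K), linEval (Fintype.card F) c (x + y) =
      linEval (Fintype.card F) c x + linEval (Fintype.card F) c y := fun c x y => by
    simp_rw [← linMap_apply (F := F), map_add]
  have hzero : ∀ (c : Fin k → K), linEval (Fintype.card F) c 0 = 0 := fun c => by
    simp_rw [← linMap_apply (F := F), map_zero]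
  simp only [starProd, queryMatrix, Matrix.add_apply, hadd, Finset.sum_add_distrib]
  congr 1
  · symm
    refine (Fintype.sum_prod_type _).trans (Finset.sum_congr rfl fun r _ => ?_)
    refine (Fintype.sum_prod_type _).trans ?_
    exact (linEval_linEval (F := F) (X r) (U r) (α j)).symm
  · rw [Fintype.sum_prod_type, Fintype.sum_eq_single f]
    · rw [Fintype.sum_prod_type]
      refine Finset.sum_congr rfl fun δ _ => ?_
      by_cases h : Requested β k i δ
      · simp only [requestPart, Matrix.of_apply, h, and_self, if_true, linEval, ← pow_mul,
          ← pow_add]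
      · simp [requestPart, h, hzero]
    · intro g hg
      refine Finset.sum_eq_zero fun δ _ => ?_
      simp [requestPart, hg, hzero]

theorem starProd_sub_padding {F K ι : Type*} [Field F] [Fintype F] [Field K] [Algebra F K]
    {m k β T : ℕ} (hβ : 0 < β) (α : ι → K) (f : Fin m) (i : ℕ)
    (X : Matrix (Fin m × Fin β) (Fin k) K) (U : Fin m × Fin β → Fin T → K) :
    starProd (Fintype.card F) X (queryMatrix (Fintype.card F) α k f i U) -
        padding (Fintype.card F) α T f i X =
      gabEncode (Fintype.card F) α (k + T + β - 1)
        (fun c => respCoeff (Fintype.card F) f i X U c) := by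
  funext j
  rw [Pi.sub_apply, starProd_queryMatrix, sub_eq_iff_eq_add]
  simp only [gabEncode, LinearMap.coe_mk, AddHom.coe_mk, linEval, respCoeff, add_mul,
    Finset.sum_add_distrib]
  rw [sum_fiber_mul_pow, sum_fiber_mul_pow, add_assoc]
  congr 1
  · refine Finset.sum_congr rfl fun p _ => ?_
    -- Products of data and random queries stay below exponent `k + T - 1`, so the truncation loses
    -- none of them.
    rw [if_pos (by have := p.2.1.2; have := p.2.2.2; omega)]
  · rw [padding, ← Fintype.sum_prod_type' (f := fun (δ : Fin β) (a : Fin k) =>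
      if Requested β k i δ ∧ k + T + β - 1 ≤ reqExp β k T i δ + a then
        X (f, δ) a * α j ^ Fintype.card F ^ (reqExp β k T i δ + a) else 0),
      ← Finset.sum_add_distrib]
    refine Finset.sum_congr rfl fun p _ => ?_
    by_cases h1 : Requested β k i p.1
    · by_cases h2 : reqExp β k T i p.1 + p.2 < k + T + β - 1
      · simp [h1, h2, not_le.mpr h2]
      · simp [h1, h2, not_lt.mp h2]
    · simp [h1]

/-- The stripe index and symbol index of a requested symbol are determined by its monomial. -/
theorem reqExp_add_eq_iff {β k T i δ a c : ℕ} (hT : 0 < T) (ha : a < k)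
    (h : Requested β k i δ) :
    reqExp β k T i δ + a = c ↔ δ * k + (k - 1 - a) + c = (i + 1) * β + T + k - 2 := by
  unfold Requested at h
  unfold reqExp
  omega

/-- Division with remainder by `k`: the quotient is the stripe, the remainder the reversed symbol
index. -/
theorem linear_index_injective {k δ a δ' a' : ℕ} (ha : a < k) (ha' : a' < k)
    (h : δ * k + (k - 1 - a) = δ' * k + (k - 1 - a')) : δ = δ' ∧ a = a' := by
  have h1 : δ = δ' := by
    have h2 := congrArg (· / k) h
    have hk : 0 < k := by omega
    simp only [mul_comm _ k, Nat.mul_add_div hk] at h2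
    rw [Nat.div_eq_of_lt (by omega), Nat.div_eq_of_lt (by omega)] at h2
    omega
  subst h1
  omega

/-- The bound on the position puts the exponent at `k + T - 1` or higher, beyond the random part. -/
theorem respCoeff_eq_of_requested {K : Type*} [Field K] {q m k β T : ℕ} (hT : 0 < T)
    (f : Fin m) (i : ℕ) (X : Matrix (Fin m × Fin β) (Fin k) K) (U : Fin m × Fin β → Fin T → K)
    {δ : Fin β} {a : Fin k} (h : (δ : ℕ) * k + (k - 1 - a) < (i + 1) * β) :
    respCoeff q f i X U (reqExp β k T i δ + a) = X (f, δ) a := by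
  have hr : Requested β k i δ := by unfold Requested; omega
  have hc := (reqExp_add_eq_iff hT a.2 hr).mp rfl
  rw [respCoeff, Finset.sum_eq_zero, zero_add, Fintype.sum_eq_single (δ, a)]
  · simp [hr]
  · rintro ⟨δ', a'⟩ hne
    by_cases hr' : Requested β k i δ'
    · rw [if_neg]
      intro he
      have he' := (reqExp_add_eq_iff hT a'.2 hr').mp he
      obtain ⟨h1, h2⟩ := linear_index_injective a'.2 a.2 (show (δ' : ℕ) * k + (k - 1 - a') =
        δ * k + (k - 1 - a) by omega)
      exact hne (Prod.ext (Fin.ext h1) (Fin.ext h2))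
    · simp [hr']
  · rintro p -
    rw [if_neg]
    have := p.2.1.2
    have := p.2.2.2
    have := a.2
    omega

/-- Subtracting two responses to the same data cancels the request part and isolates one random
monomial. -/
theorem respCoeff_single {K : Type*} [Field K] {q m k β T : ℕ} (hq : q ≠ 0) (f : Fin m) (i : ℕ)
    (r : Fin m × Fin β) (a : Fin k) (d : Fin T) (c : ℕ) :
    respCoeff q f i (Matrix.single r a (1 : K)) (Pi.single r (Pi.single d 1)) c -
      respCoeff q f i (Matrix.single r a (1 : K)) (0 : Fin m × Fin β → Fin T → K) c =
      if (a : ℕ) + d = c then 1 else 0 := by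
  rw [respCoeff, respCoeff, add_sub_add_right_eq_sub, Fintype.sum_eq_single (r, a, d),
    Finset.sum_eq_zero]
  · simp
  · intro p _
    simp [hq]
  · rintro ⟨r', a', d'⟩ hne
    by_cases hr : r' = r
    · subst hr
      by_cases ha : a' = a
      · subst ha
        have hd : d' ≠ d := fun h => hne (by rw [h])
        simp [hd, hq]
      · simp [Matrix.single, Ne.symm ha]
    · simp [Matrix.single, Ne.symm hr]

theorem responseCode_eq_gabidulin {F K ι : Type*} [Field F] [Fintype F] [Field K] [Algebra F K]
    {m k β T : ℕ} (hβ : 0 < β) (hT : 0 < T) (α : ι → K) (f : Fin m) {i : ℕ} (hi : i < k) :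
    responseCode (Fintype.card F) α β k T f i =
      gabidulin (Fintype.card F) α (k + T + β - 1) := by
  have hq : Fintype.card F ≠ 0 := Fintype.card_ne_zero
  apply le_antisymm
  · refine Submodule.span_le.mpr ?_
    rintro _ ⟨X, U, rfl⟩
    rw [starProd_sub_padding (F := F) hβ]
    exact ⟨_, rfl⟩
  · have hmem : ∀ (X : Matrix (Fin m × Fin β) (Fin k) K) (U : Fin m × Fin β → Fin T → K),
        gabEncode (Fintype.card F) α (k + T + β - 1)
          (fun c => respCoeff (Fintype.card F) f i X U c) ∈
            responseCode (Fintype.card F) α β k T f i := fun X U =>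
      Submodule.subset_span ⟨X, U, (starProd_sub_padding (F := F) hβ α f i X U).symm⟩
    rw [gabidulin, LinearMap.range_eq_map, ← (Pi.basisFun K _).span_eq, Submodule.map_span,
      Submodule.span_le]
    rintro _ ⟨_, ⟨c, rfl⟩, rfl⟩
    rw [Pi.basisFun_apply, SetLike.mem_coe]
    by_cases hc : (c : ℕ) < k + T - 1
    · let a : Fin k := ⟨min (c : ℕ) (k - 1), by omega⟩
      let d : Fin T := ⟨(c : ℕ) - min (c : ℕ) (k - 1), by omega⟩
      have had : (a : ℕ) + d = c := by simp only [a, d]; omega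
      have := Submodule.sub_mem _ (hmem (Matrix.single (f, ⟨0, hβ⟩) a 1)
        (Pi.single (f, ⟨0, hβ⟩) (Pi.single d 1))) (hmem (Matrix.single (f, ⟨0, hβ⟩) a 1) 0)
      rw [← map_sub] at this
      convert this using 2
      funext c'
      rw [Pi.sub_apply, respCoeff_single hq, had, Pi.single_apply]
      simp only [Fin.ext_iff, eq_comm]
    · have hk : 0 < k := by omega
      have hib : (i + 1) * β ≤ k * β := Nat.mul_le_mul_right β hi
      have hib' : (i + 1) * β = i * β + β := by ring
      have hcN := c.2
      -- Higher monomials come from a single file symbol without randomness; `v` is its position,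
      -- decoded by division by `k`.
      obtain ⟨v, hv⟩ : ∃ v, v + c = (i + 1) * β + T + k - 2 :=
        ⟨(i + 1) * β + T + k - 2 - c, by omega⟩
      have hvlt : v < (i + 1) * β := by omega
      have hmod : v % k < k := Nat.mod_lt v hk
      have hdm : v / k * k + v % k = v := Nat.div_add_mod' v k
      let δ : Fin β := ⟨v / k, by rw [Nat.div_lt_iff_lt_mul hk, mul_comm]; omega⟩
      let a : Fin k := ⟨k - 1 - v % k, by omega⟩
      have hva : (δ : ℕ) * k + (k - 1 - a) = v := by simp only [δ, a]; omega
      have hreq : Requested β k i δ := by unfold Requested; omega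
      have hca : reqExp β k T i δ + a = c := (reqExp_add_eq_iff hT a.2 hreq).mpr (by omega)
      convert hmem (Matrix.single (f, δ) a 1) 0 using 2
      funext c'
      rw [respCoeff, Finset.sum_eq_zero (by intro p _; simp [hq]), zero_add,
        Fintype.sum_eq_single (δ, a), hca, Pi.single_apply]
      · simp [hreq, Fin.ext_iff, eq_comm]
      · rintro ⟨δ', a'⟩ hne
        have h0 : Matrix.single (f, δ) a (1 : K) (f, δ') a' = 0 := by
          rw [Matrix.single_apply, if_neg]
          rintro ⟨h1, h2⟩
          exact hne (by simp_all)
        simp [h0]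

/-! ### Transmission through the network -/

theorem expand_sub {F K ι : Type*} [Field F] [Field K] [Algebra F K] {s : ℕ}
    (b : Module.Basis (Fin s) F K) (v w : ι → K) :
    expand b (v - w) = expand b v - expand b w := by
  ext j a
  simp [expand]

theorem expand_mulVec {F K ι : Type*} [Field F] [Field K] [Algebra F K] [Fintype ι] {s : ℕ}
    (b : Module.Basis (Fin s) F K) (A : Matrix ι ι F) (v : ι → K) :
    expand b (A.map (algebraMap F K) *ᵥ v) = A * expand b v := by
  ext j a
  simp [expand, Matrix.mulVec, dotProduct, Matrix.mul_apply, ← Algebra.smul_def, map_sum]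

/-- Linearized polynomials are `F`-linear, so they commute with mixing by a matrix over `F`. -/
theorem starProd_uplink {F K ι R : Type*} [Field F] [Fintype F] [Field K] [Algebra F K]
    [Fintype ι] [Fintype R] {k : ℕ} (X : Matrix R (Fin k) K) (A : Matrix ι ι F)
    (Q : Matrix ι R K) :
    starProd (Fintype.card F) X (uplink A Q) =
      A.map (algebraMap F K) *ᵥ starProd (Fintype.card F) X Q := by
  funext j
  simp only [starProd, uplink, Matrix.mulVec, dotProduct, Matrix.mul_apply, Matrix.map_apply,
    Finset.mul_sum, ← linMap_apply (F := F), map_sum]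
  rw [Finset.sum_comm]
  refine Finset.sum_congr rfl fun j' _ => Finset.sum_congr rfl fun r _ => ?_
  rw [← Algebra.smul_def, ← Algebra.smul_def, map_smul]

/-- Two transmissions which the user cannot distinguish carry words at rank distance at most
`2 * ε + τ`. -/
theorem rank_expand_sub_le_of_downlink_eq {F K ι : Type*} [Field F] [Field K] [Algebra F K]
    [Fintype ι] [DecidableEq ι] {s ε τ : ℕ} (b : Module.Basis (Fin s) F K)
    {A₁ A₁' A₂ A₂' : Matrix ι ι F} {y₁ y₂ : ι → K} {N₁ N₂ : Matrix ι (ι ⊕ (ι ⊕ Fin s)) F}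
    (h₂ : Fintype.card ι ≤ (A₂' * A₂).rank + τ) (hN₁ : N₁.rank ≤ ε) (hN₂ : N₂.rank ≤ ε)
    (h : downlink b A₁ A₁' (A₁.map (algebraMap F K) *ᵥ y₁) N₁ =
      downlink b A₂ A₂' (A₂.map (algebraMap F K) *ᵥ y₂) N₂) :
    (expand b (y₁ - y₂)).rank ≤ 2 * ε + τ := by
  -- `M` annihilates every noiseless lifted matrix `(I | A | A y₁)`, so the first transmission
  -- leaves only its noise, and the second leaves `A₂' A₂ (y₁ - y₂)` plus noise.
  let M : Matrix (ι ⊕ (ι ⊕ Fin s)) (Fin s) F := fromRows 0 (fromRows (expand b y₁) (-1))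
  have key : ∀ (A A' : Matrix ι ι F) (y : ι → K) (N : Matrix ι (ι ⊕ (ι ⊕ Fin s)) F),
      downlink b A A' (A.map (algebraMap F K) *ᵥ y) N * M =
        A' * A * expand b (y₁ - y) + N * M := by
    intro A A' y N
    simp only [downlink, M, expand_mulVec, Matrix.add_mul, Matrix.mul_assoc,
      fromCols_mul_fromRows, expand_sub, Matrix.mul_sub, Matrix.mul_zero, zero_add,
      Matrix.mul_neg, Matrix.mul_one]
    congr 1
    rw [sub_eq_add_neg, Matrix.mul_add, Matrix.mul_neg]
  have heq := congrArg (· * M) h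
  simp only [key, sub_self] at heq
  have h0 : expand b (0 : ι → K) = 0 := by
    ext
    simp [expand]
  rw [h0, Matrix.mul_zero, zero_add] at heq
  have hB : A₂' * A₂ * expand b (y₁ - y₂) = (N₁ - N₂) * M := by
    rw [Matrix.sub_mul, heq, add_sub_cancel_right]
  have hs := rank_add_rank_le_rank_mul_add_card (A₂' * A₂) (expand b (y₁ - y₂))
  have h3 := (N₁ - N₂).rank_mul_le_left M
  have h4 := rank_sub_le_add N₁ N₂
  rw [hB] at hs
  omega

/-! ### Recovery round by round -/

theorem eq_of_rank_expand_sub_lt_minRankDist {F K ι : Type*} [Field F] [Field K] [Algebra F K]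
    {s : ℕ} (b : Module.Basis (Fin s) F K) {C : Set (ι → K)} {x y : ι → K} (hx : x ∈ C)
    (hy : y ∈ C) (h : (expand b (x - y)).rank < minRankDist b C) : x = y := by
  by_contra hne
  refine absurd ?_ (not_le.mpr h)
  exact Nat.sInf_le ⟨x, hx, y, hy, hne, rfl⟩

/-- An exponent of at least `k + T + β - 1` means a position below `i * β`. -/
theorem padding_congr {K ι : Type*} [Field K] {q m k β T : ℕ} (hT : 0 < T)
    (α : ι → K) (f : Fin m) (i : ℕ) {X X' : Matrix (Fin m × Fin β) (Fin k) K}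
    (h : ∀ (δ : Fin β) (a : Fin k), (δ : ℕ) * k + (k - 1 - a) < i * β →
      X (f, δ) a = X' (f, δ) a) :
    padding q α T f i X = padding q α T f i X' := by
  funext j
  refine Finset.sum_congr rfl fun δ _ => Finset.sum_congr rfl fun a _ => ?_
  split_ifs with hc
  · have h1 := (reqExp_add_eq_iff hT a.2 hc.1).mp rfl
    have h2 : (i + 1) * β = i * β + β := by ring
    rw [h δ a (by have := a.2; omega)]
  · rfl

/-- If the responses of every round are indistinguishable up to an amount which the response code
can correct, then the requested files and the error-free responses agree. -/
theorem responses_eq_of_rank_lt {F K ι : Type*} [Field F] [Fintype F] [Field K] [Algebra F K]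
    [Fintype ι] {s m k β T : ℕ} (b : Module.Basis (Fin s) F K) {α : ι → K}
    (hα : LinearIndependent F α) (hβ : 0 < β) (hT : 0 < T)
    (hn : k + T + β - 1 ≤ Fintype.card ι) (f : Fin m)
    {X X' : Matrix (Fin m × Fin β) (Fin k) K} {U U' : Fin k → Fin m × Fin β → Fin T → K}
    (h : ∀ i : Fin k, (expand b
      (starProd (Fintype.card F) X (queryMatrix (Fintype.card F) α k f i (U i)) -
        starProd (Fintype.card F) X' (queryMatrix (Fintype.card F) α k f i (U' i)))).rank <
      minRankDist b (responseCode (Fintype.card F) α β k T f i : Set (ι → K))) :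
    (∀ i : Fin k, starProd (Fintype.card F) X (queryMatrix (Fintype.card F) α k f i (U i)) =
      starProd (Fintype.card F) X' (queryMatrix (Fintype.card F) α k f i (U' i))) ∧
    file X f = file X' f := by
  have round : ∀ i : Fin k, (∀ (δ : Fin β) (a : Fin k), (δ : ℕ) * k + (k - 1 - a) < i * β →
      X (f, δ) a = X' (f, δ) a) →
      starProd (Fintype.card F) X (queryMatrix (Fintype.card F) α k f i (U i)) =
        starProd (Fintype.card F) X' (queryMatrix (Fintype.card F) α k f i (U' i)) := by
    intro i hX
    have hp := padding_congr (q := Fintype.card F) hT α f i hX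
    have := eq_of_rank_expand_sub_lt_minRankDist b
      (C := (responseCode (Fintype.card F) α β k T f i : Set (ι → K)))
      (Submodule.subset_span ⟨X, U i, rfl⟩) (Submodule.subset_span ⟨X', U' i, rfl⟩)
      (by rw [hp, sub_sub_sub_cancel_right]; exact h i)
    rwa [hp, sub_left_inj] at this
  -- After `i` rounds the symbols at the first `i * β` positions agree; `i = k` covers the whole
  -- file.
  have known : ∀ i : ℕ, i ≤ k → ∀ (δ : Fin β) (a : Fin k),
      (δ : ℕ) * k + (k - 1 - a) < i * β → X (f, δ) a = X' (f, δ) a := by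
    intro i
    induction i with
    | zero => intro _ δ a h0; omega
    | succ i ih =>
      intro hi δ a hv
      have hX := ih (by omega)
      by_cases hlt : (δ : ℕ) * k + (k - 1 - a) < i * β
      · exact hX δ a hlt
      have hy := round ⟨i, hi⟩ hX
      have hp := padding_congr (q := Fintype.card F) hT α f i hX
      have hd := congrArg (· - padding (Fintype.card F) α T f i X) hy
      simp only at hd
      rw [starProd_sub_padding (F := F) hβ, hp, starProd_sub_padding (F := F) hβ] at hd
      have hc := gabEncode_injective b hα hn hd
      have hr : Requested β k i δ := by unfold Requested; omega
      have he := (reqExp_add_eq_iff hT a.2 hr).mp rfl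
      have hib : (i + 1) * β = i * β + β := by ring
      have := congrFun hc ⟨reqExp β k T i δ + a, by have := a.2; omega⟩
      simpa only [respCoeff_eq_of_requested hT f i _ _ hv] using this
  refine ⟨fun i => round i (known i i.2.le), ?_⟩
  ext δ a
  refine known k le_rfl δ a ?_
  have h1 : ((δ : ℕ) + 1) * k ≤ β * k := Nat.mul_le_mul_right k δ.2
  rw [add_mul, one_mul, mul_comm β] at h1
  have := a.2
  omega

theorem pirRate_eq {F K : Type*} [Field F] [Field K] [Algebra F K] {s k l ρ β : ℕ}
    (b : Module.Basis (Fin s) F K) (hk : 0 < k) :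
    pirRate F (Matrix (Fin β) (Fin k) K) (Fin k → Fin ρ → K) l = β / (ρ * l) := by
  have : FiniteDimensional F K := b.finiteDimensional_of_finite
  have hs : (Module.finrank F K : ℚ) ≠ 0 := by
    exact_mod_cast (Module.finrank_pos (R := F) (M := K)).ne'
  have hk' : (k : ℚ) ≠ 0 := by exact_mod_cast hk.ne'
  rw [pirRate, Module.finrank_matrix, Module.finrank_pi_fintype]
  simp only [Module.finrank_pi_fintype, Finset.sum_const, Finset.card_univ, Fintype.card_fin,
    smul_eq_mul]
  push_cast
  rw [show (β : ℚ) * k * Module.finrank F K = (k * Module.finrank F K) * β by ring,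
    show (l : ℚ) * (k * (ρ * Module.finrank F K)) = (k * Module.finrank F K) * (ρ * l) by ring,
    mul_div_mul_left _ _ (mul_ne_zero hk' hs)]

end RankPIR

theorem theorem3 {F K : Type*} [Field F] [Fintype F] [Field K] [Algebra F K]
    {s m k t l ρ β : ℕ} (b : Module.Basis (Fin s) F K)
    (α : Fin ρ × Fin l → K) (hα : LinearIndependent F α)
    (hk : 0 < k) (ht : 0 < t) (hβ : 0 < β) (hn : k + t * ρ + β - 1 ≤ ρ * l) (f : Fin m) :
    -- the response code is a Gabidulin code with `d = n - k - t * ρ - β + 2`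
    (∀ i : Fin k,
      responseCode (Fintype.card F) α β k (t * ρ) f i =
        gabidulin (Fintype.card F) α (k + t * ρ + β - 1) ∧
      minRankDist b (responseCode (Fintype.card F) α β k (t * ρ) f i : Set (Fin ρ × Fin l → K)) +
        (k + t * ρ + β) = ρ * l + 2) ∧
    ∀ ε τ : ℕ,
      -- the designed number of stripes meets the condition `2 * ε + τ ≤ d - 1`
      (β + (k + t * ρ + 2 * ε + τ) = ρ * l + 1 →
        ∀ i : Fin k, 2 * ε + τ + 1 ≤ minRankDist b
          (responseCode (Fintype.card F) α β k (t * ρ) f i : Set (Fin ρ × Fin l → K))) ∧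
      -- under this condition the user corrects the errors and erasures and retrieves the file
      ((∀ i : Fin k, 2 * ε + τ + 1 ≤ minRankDist b
          (responseCode (Fintype.card F) α β k (t * ρ) f i : Set (Fin ρ × Fin l → K))) →
        (∃ decode : (Fin k → Matrix (Fin ρ × Fin l)
              ((Fin ρ × Fin l) ⊕ ((Fin ρ × Fin l) ⊕ Fin s)) F) →
            (Fin k → Fin ρ × Fin l → K) × Matrix (Fin β) (Fin k) K,
          ∀ (X : Matrix (Fin m × Fin β) (Fin k) K)
            (U : Fin k → Fin m × Fin β → Fin (t * ρ) → K)
            (A A' : Fin k → Fin l → Matrix (Fin ρ) (Fin ρ) F)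
            (N : Fin k → Matrix (Fin ρ × Fin l) ((Fin ρ × Fin l) ⊕ ((Fin ρ × Fin l) ⊕ Fin s)) F),
            (∀ i, ρ * l ≤ (blockDiagonal (A' i) * blockDiagonal (A i)).rank + τ) →
            (∀ i, (N i).rank ≤ ε) →
            decode (fun i => downlink b (blockDiagonal (A i)) (blockDiagonal (A' i))
                (starProd (Fintype.card F) X (uplink (blockDiagonal (A i))
                  (queryMatrix (Fintype.card F) α k f i (U i)))) (N i)) =
              (fun i : Fin k => starProd (Fintype.card F) X (queryMatrix (Fintype.card F) α k f i (U i)),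
                file X f)) ∧
        pirRate F (Matrix (Fin β) (Fin k) K) (Fin k → Fin ρ → K) l = β / (ρ * l)) := by 
  have hcard : Fintype.card (Fin ρ × Fin l) = ρ * l := by simp
  have hρ : 0 < ρ := by
    rcases Nat.eq_zero_or_pos ρ with rfl | h
    -- With `ρ = 0` the length bound would force `k + β - 1 ≤ 0`.
    · simp only [Nat.mul_zero, Nat.zero_mul] at hn
      omega
    · exact h
  have hT : 0 < t * ρ := Nat.mul_pos ht hρ
  have hcode := fun i : Fin k => responseCode_eq_gabidulin (F := F) hβ hT α f i.2
  have hdist : ∀ i : Fin k, minRankDist b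
      (responseCode (Fintype.card F) α β k (t * ρ) f i : Set (Fin ρ × Fin l → K)) +
        (k + t * ρ + β) = ρ * l + 2 := by
    intro i
    have := minRankDist_gabidulin b hα (N := k + t * ρ + β - 1) (by omega) (by omega)
    rw [hcode i]
    omega
  refine ⟨fun i => ⟨hcode i, hdist i⟩, fun ε τ => ⟨fun hpar i => ?_, fun hd => ⟨?_, ?_⟩⟩⟩
  · have := hdist i
    omega
  · classical
    let Scenario := { p : Matrix (Fin m × Fin β) (Fin k) K ×
        (Fin k → Fin m × Fin β → Fin (t * ρ) → K) ×
        (Fin k → Fin l → Matrix (Fin ρ) (Fin ρ) F) × (Fin k → Fin l → Matrix (Fin ρ) (Fin ρ) F) ×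
        (Fin k → Matrix (Fin ρ × Fin l) ((Fin ρ × Fin l) ⊕ ((Fin ρ × Fin l) ⊕ Fin s)) F) //
      (∀ i, ρ * l ≤ (blockDiagonal (p.2.2.2.1 i) * blockDiagonal (p.2.2.1 i)).rank + τ) ∧
        ∀ i, (p.2.2.2.2 i).rank ≤ ε }
    let received : Scenario → Fin k → Matrix (Fin ρ × Fin l)
        ((Fin ρ × Fin l) ⊕ ((Fin ρ × Fin l) ⊕ Fin s)) F := fun p i =>
      downlink b (blockDiagonal (p.1.2.2.1 i)) (blockDiagonal (p.1.2.2.2.1 i))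
        (starProd (Fintype.card F) p.1.1 (uplink (blockDiagonal (p.1.2.2.1 i))
          (queryMatrix (Fintype.card F) α k f i (p.1.2.1 i)))) (p.1.2.2.2.2 i)
    let result : Scenario → (Fin k → Fin ρ × Fin l → K) × Matrix (Fin β) (Fin k) K := fun p =>
      (fun i : Fin k => starProd (Fintype.card F) p.1.1
        (queryMatrix (Fintype.card F) α k f i (p.1.2.1 i)), file p.1.1 f)
    have hfactors : result.FactorsThrough received := by
      intro p p' hpp'
      have := responses_eq_of_rank_lt b hα hβ hT (by omega) f (X := p.1.1) (X' := p'.1.1)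
        (U := p.1.2.1) (U' := p'.1.2.1) fun i => by
          refine lt_of_le_of_lt ?_ (hd i)
          have hi := congrFun hpp' i
          simp only [received, starProd_uplink] at hi
          exact rank_expand_sub_le_of_downlink_eq b (by rw [hcard]; exact p'.2.1 i) (p.2.2 i)
            (p'.2.2 i) hi
      exact Prod.ext (funext this.1) this.2
    -- The value `0` is used only on matrices that no admissible scenario produces.
    refine ⟨Function.extend received result fun _ => 0, fun X U A A' N hA hN => ?_⟩
    exact hfactors.extend_apply _ (⟨(X, U, A, A', N), hA, hN⟩ : Scenario)
  · exact pirRate_eq b hk
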